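/- Let $\mathbf G$ and $\mathbf H$ be independent random $2\times2$ complex matrices, each with independent $\mathcal{CN}(0,1)$ (standard circularly symmetric complex Gaussian) entries. Let $\mathbf G=\mathbf U\sqrt{\boldsymbol\Lambda}\,\mathbf V^\dagger$ and $\mathbf H=\mathbf W\sqrt{\boldsymbol\Omega}\,\mathbf Q^\dagger$ be singular value decompositions, almost surely, where $\mathbf U,\mathbf V,\mathbf W,\mathbf Q$ are unitary and $\boldsymbol\Lambda=\mathrm{diag}(\lambda_1,\lambda_2)$, $\boldsymbol\Omega=\mathrm{diag}(\omega_1,\omega_2)$ contain the squared singular values in decreasing order. Let $\mathbf v_j=(v_{j1},v_{j2})^T$ be the $j$-th column of $\mathbf V$ and $\mathbf w_i=(w_{i1},w_{i2})^T$ the $i$-th column of $\mathbf W$, and let $\boldsymbol\Phi=\mathrm{diag}(e^{\mathrm i\phi_1},e^{\mathrm i\phi_2})$ with fixed real $\phi_1,\phi_2$. For $i,j\in\{1,2\}$ define $$Z_{j,\mathrm{cmp}}^{(i)}=\left(|v_{j1}||w_{i1}|+|v_{j2}||w_{i2}|\right)^2,\qquad Z_j^{(i)}=\left|\mathbf v_j^\dagger\boldsymbol\Phi\mathbf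 w_i\right|^2 .$$ Then, for $i,j\in\{1,2\}$, up to a null set both quantities are random variables (measurable), and for $z\in(0,1)$ their cumulative distribution functions are $$F_{Z_{j,\mathrm{cmp}}^{(i)}}(z)=z-\sqrt{z(1-z)}\,\arcsin\left(\sqrt z\right),\qquad F_{Z_j^{(i)}}(z)=z .$$ In particular, $Z_j^{(i)}$ is uniformly distributed on $[0,1]$. -/

import Mathlib

open MeasureTheory ProbabilityTheory
open scoped NNReal Matrix

noncomputable section

/-- The standard circularly symmetric complex Gaussian law `CN(0,1)`: independent real and
imaginary parts, each real Gaussian with mean `0` and variance `1/2`. -/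
def stdComplexGaussian : Measure ℂ :=
  ((gaussianReal 0 (1 / 2 : ℝ≥0)).prod (gaussianReal 0 (1 / 2 : ℝ≥0))).map
    (fun p : ℝ × ℝ => (⟨p.1, p.2⟩ : ℂ))

/-- The random `2 × 2` matrix `M` has independent entries, each with law `CN(0,1)`. -/
structure IsIIDGaussianMatrix {Ω : Type*} [MeasurableSpace Ω] (μ : Measure Ω)
    (M : Ω → Matrix (Fin 2) (Fin 2) ℂ) : Prop where
  hasLaw_entry : ∀ a b : Fin 2, HasLaw (fun x => M x a b) stdComplexGaussian μ
  indep_entries : iIndepFun (fun (p : Fin 2 × Fin 2) (x : Ω) => M x p.1 p.2) μ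

/-- `M = U √Λ V†` is a singular value decomposition of `M`, where `Λ = diag (lam 0, lam 1)` holds
the squares of the singular values in decreasing order. -/
structure IsOrderedSVD (M U : Matrix (Fin 2) (Fin 2) ℂ) (lam : Fin 2 → ℝ)
    (V : Matrix (Fin 2) (Fin 2) ℂ) : Prop where
  left_unitary : U ∈ Matrix.unitaryGroup (Fin 2) ℂ
  right_unitary : V ∈ Matrix.unitaryGroup (Fin 2) ℂ
  nonneg : 0 ≤ lam 1
  ordered : lam 1 ≤ lam 0
  eq_mul : M = U * Matrix.diagonal (fun k => (Real.sqrt (lam k) : ℂ)) * Vᴴ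

/-- The reflection matrix `Φ = diag (exp (i φ₁), exp (i φ₂))`. -/
def phaseMatrix (φ : Fin 2 → ℝ) : Matrix (Fin 2) (Fin 2) ℂ :=
  Matrix.diagonal (fun k => Complex.exp (Complex.I * (φ k : ℂ)))

/-- `|v† Φ w|²`. -/
def uncompensatedGain (φ : Fin 2 → ℝ) (v w : Fin 2 → ℂ) : ℝ :=
  ‖star v ⬝ᵥ (phaseMatrix φ *ᵥ w)‖ ^ 2

/-- `(|v₁| |w₁| + |v₂| |w₂|)²`. -/
def compensatedGain (v w : Fin 2 → ℂ) : ℝ :=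
  (‖v 0‖ * ‖w 0‖ + ‖v 1‖ * ‖w 1‖) ^ 2

end

/-!
The singular vectors enter both gains only through their rank-one projections, which are unique once
the singular values are distinct. For a `2 × 2` matrix this projection is explicit: `spectralGain`
writes `|v† u|²` as a measurable function of the matrix and of `u`. Singular values coincide only if
the diagonal entries have the same modulus, which is a null event. This yields measurability for
arbitrary, possibly non-measurable, choices of the decompositions, and lets independence and
Fubini's theorem be applied to the matrices themselves.

The main fact (`map_spectralGain`) is that `|v† u|²` is uniform on `[0, 1]` for a fixed unit vector
`u`. The Gaussian law is invariant under norm-preserving real-linear maps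
(`measurePreserving_gaussian_of_sum_norm_sq`), so the law of `|v† u|²` is the same for all unit
vectors `u`. It is therefore also the law obtained from the random direction `g / |g|`, where `g` is
a Gaussian vector independent of the matrix. For a fixed matrix with `V` unitary, `Vᴴ g` is again
Gaussian, so `|v† g|² / |g|²` is distributed like `E₁ / (E₁ + E₂)` with independent exponential
variables, which is uniform (`map_coord_div_sqNorm`).

Conditionally on `H`, the uncompensated gain is `|v† u|²` with the fixed unit vector `u = Φ w`, so it
is uniform. The compensated gain is `(√(a b) + √((1 - a) (1 - b)))²` with independent uniform
`a = |v₁|²` and `b = |w₁|²`. With `a = cos² α`, `b = cos² β` and `z = cos² θ` it is at most `z` exactly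
when `β ≤ α - θ` or `β ≥ α + θ`. For fixed `a` this gives two intervals of values of `b`
(`volume_slice`); integrating their lengths over `a` gives the distribution function.
-/

/-! ### Gaussian measures -/

instance : IsProbabilityMeasure stdComplexGaussian := by
  unfold stdComplexGaussian
  exact Measure.isProbabilityMeasure_map
    (Complex.measurableEquivRealProd.symm.measurable.aemeasurable)

lemma charFun_stdComplexGaussian (t : ℂ) :
    charFun stdComplexGaussian t = Complex.exp (-(‖t‖ ^ 2 : ℝ) / 4) := by
  rw [charFun_apply]
  unfold stdComplexGaussian
  have hm : Measurable (fun p : ℝ × ℝ => (⟨p.1, p.2⟩ : ℂ)) :=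
    Complex.measurableEquivRealProd.symm.measurable
  rw [integral_map hm.aemeasurable (by fun_prop)]
  have h : ∀ p : ℝ × ℝ, Complex.exp ((inner ℝ (⟨p.1, p.2⟩ : ℂ) t : ℝ) * Complex.I)
      = Complex.exp (t.re * p.1 * Complex.I) * Complex.exp (t.im * p.2 * Complex.I) := by
    intro p
    rw [← Complex.exp_add]
    simp only [Complex.inner, Complex.mul_re, Complex.conj_re, Complex.conj_im]
    push_cast
    ring_nf
  simp_rw [h]
  rw [integral_prod_mul (fun x : ℝ => Complex.exp (t.re * x * Complex.I))
    (fun y : ℝ => Complex.exp (t.im * y * Complex.I)), ← charFun_apply_real,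
    ← charFun_apply_real, charFun_gaussianReal, charFun_gaussianReal, ← Complex.exp_add]
  rw [← Complex.normSq_eq_norm_sq, Complex.normSq_apply]
  push_cast
  ring_nf

/-- Real-linear maps that preserve the Euclidean norm preserve a standard complex Gaussian vector:
its characteristic function depends on the norm of its argument only. -/
lemma measurePreserving_gaussian_of_sum_norm_sq {ι : Type*} [Fintype ι]
    (e : (ι → ℂ) →ₗ[ℝ] (ι → ℂ)) (he : ∀ z, ∑ i, ‖e z i‖ ^ 2 = ∑ i, ‖z i‖ ^ 2) :
    MeasurePreserving e (Measure.pi fun _ : ι => stdComplexGaussian)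
      (Measure.pi fun _ : ι => stdComplexGaussian) := by
  have hem : Measurable e := (LinearMap.continuous_of_finiteDimensional e).measurable
  refine ⟨hem, ?_⟩
  let f₀ : PiLp 2 (fun _ : ι => ℂ) →ₗᵢ[ℝ] PiLp 2 (fun _ : ι => ℂ) :=
    { toLinearMap := ((WithLp.linearEquiv 2 ℝ (ι → ℂ)).symm.toLinearMap ∘ₗ e ∘ₗ
        (WithLp.linearEquiv 2 ℝ (ι → ℂ)).toLinearMap)
      norm_map' := by
        intro x
        rw [PiLp.norm_eq_of_L2, PiLp.norm_eq_of_L2]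
        congr 1
        exact he _ }
  let f : PiLp 2 (fun _ : ι => ℂ) ≃ₗᵢ[ℝ] PiLp 2 (fun _ : ι => ℂ) :=
    f₀.toLinearIsometryEquiv rfl
  have hfe : ∀ z, f (WithLp.toLp 2 z) = WithLp.toLp 2 (e z) := fun z => rfl
  have hc : ∀ t, charFun ((Measure.pi fun _ : ι => stdComplexGaussian).map (WithLp.toLp 2)) t
      = Complex.exp (-(‖t‖ ^ 2 : ℝ) / 4) := by
    intro t
    rw [charFun_pi]
    simp_rw [charFun_stdComplexGaussian]
    rw [← Complex.exp_sum, PiLp.norm_sq_eq_of_L2]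
    push_cast
    rw [← Finset.sum_div, Finset.sum_neg_distrib]
  have hfm : Measurable f := f.continuous.measurable
  have key : ((Measure.pi fun _ : ι => stdComplexGaussian).map (WithLp.toLp 2)).map f
      = (Measure.pi fun _ : ι => stdComplexGaussian).map (WithLp.toLp 2) := by
    have : IsProbabilityMeasure
      ((Measure.pi fun _ : ι => stdComplexGaussian).map (WithLp.toLp 2)) :=
      Measure.isProbabilityMeasure_map (by fun_prop)
    have : IsProbabilityMeasure
      (((Measure.pi fun _ : ι => stdComplexGaussian).map (WithLp.toLp 2)).map f) :=
      Measure.isProbabilityMeasure_map (by fun_prop)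
    apply Measure.ext_of_charFun
    ext t
    rw [charFun_apply, integral_map hfm.aemeasurable (by fun_prop)]
    have h2 : ∀ x, inner ℝ (f x) t = inner ℝ x (f.symm t) := by
      intro x
      rw [← f.inner_map_map x, f.apply_symm_apply]
    simp_rw [h2]
    rw [← charFun_apply, hc, hc, f.symm.norm_map]
  have h3 := congrArg (Measure.map (WithLp.ofLp)) key
  rw [Measure.map_map hfm (by fun_prop), Measure.map_map (by fun_prop) (by fun_prop),
    Measure.map_map (by fun_prop) (by fun_prop)] at h3
  have h4 : (WithLp.ofLp ∘ (f ∘ WithLp.toLp 2) : (ι → ℂ) → (ι → ℂ)) = e := rfl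
  have h5 : (WithLp.ofLp ∘ WithLp.toLp 2 : (ι → ℂ) → (ι → ℂ)) = id := rfl
  rw [h4, h5, Measure.map_id] at h3
  exact h3

lemma stdComplexGaussian_eq_withDensity :
    stdComplexGaussian = (volume : Measure ℂ).withDensity
      (fun z => ENNReal.ofReal (Real.pi⁻¹ * Real.exp (-‖z‖ ^ 2))) := by
  unfold stdComplexGaussian
  rw [gaussianReal_of_var_ne_zero _ (by norm_num), prod_withDensity (by fun_prop) (by fun_prop)]
  have hm : MeasurePreserving (fun p : ℝ × ℝ => (⟨p.1, p.2⟩ : ℂ)) volume volume :=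
    Complex.volume_preserving_equiv_real_prod.symm
  ext s hs
  rw [Measure.map_apply hm.measurable hs, withDensity_apply _ (hm.measurable hs),
    withDensity_apply _ hs, ← hm.setLIntegral_comp_preimage hs (by fun_prop)]
  refine lintegral_congr fun p => ?_
  simp only [gaussianPDF]
  rw [← ENNReal.ofReal_mul (gaussianPDFReal_nonneg _ _ _)]
  congr 1
  simp only [gaussianPDFReal]
  rw [← Complex.normSq_eq_norm_sq, Complex.normSq_apply]
  have hp : √(2 * Real.pi * ((1 / 2 : ℝ≥0) : ℝ)) ^ 2 = Real.pi := by
    rw [Real.sq_sqrt (by positivity)]; push_cast; ring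
  have hp' : (√(2 * Real.pi * ((1 / 2 : ℝ≥0) : ℝ)))⁻¹ * (√(2 * Real.pi * ((1 / 2 : ℝ≥0) : ℝ)))⁻¹
      = Real.pi⁻¹ := by rw [← mul_inv, ← sq, hp]
  rw [← hp']
  have : Real.exp (-(p.1 * p.1 + p.2 * p.2))
    = Real.exp (-(p.1 - 0) ^ 2 / (2 * ((1 / 2 : ℝ≥0) : ℝ)))
      * Real.exp (-(p.2 - 0) ^ 2 / (2 * ((1 / 2 : ℝ≥0) : ℝ))) := by
    rw [← Real.exp_add]; congr 1; push_cast; ring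
  rw [this]
  ring

/-- The squared modulus of a standard complex Gaussian variable is exponential of rate `1`. -/
lemma stdComplexGaussian_le_norm_sq {s : ℝ} (hs : 0 ≤ s) :
    stdComplexGaussian {z | s ≤ ‖z‖ ^ 2} = ENNReal.ofReal (Real.exp (-s)) := by
  have hms : MeasurableSet {z : ℂ | s ≤ ‖z‖ ^ 2} := measurableSet_le (by fun_prop) (by fun_prop)
  rw [stdComplexGaussian_eq_withDensity, withDensity_apply _ hms,
    ← lintegral_indicator hms, ← Complex.lintegral_comp_polarCoord_symm]
  have h1 : ∀ p ∈ polarCoord.target, ENNReal.ofReal p.1 •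
      ({z : ℂ | s ≤ ‖z‖ ^ 2}.indicator
        (fun z => ENNReal.ofReal (Real.pi⁻¹ * Real.exp (-‖z‖ ^ 2)))) (Complex.polarCoord.symm p)
      = (Set.Ici (√s)).indicator
          (fun r => ENNReal.ofReal (r * (Real.pi⁻¹ * Real.exp (-r ^ 2)))) p.1 * 1 := by
    rintro p ⟨hp, -⟩
    have hp : 0 < p.1 := hp
    have hiff : s ≤ p.1 ^ 2 ↔ √s ≤ p.1 := (Real.sqrt_le_left hp.le).symm
    simp only [Set.indicator, Set.mem_ofPred_eq, Complex.norm_polarCoord_symm, sq_abs, Set.mem_Ici,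
      hiff]
    split_ifs
    · rw [smul_eq_mul, ← ENNReal.ofReal_mul hp.le, mul_one]
    · simp
  rw [setLIntegral_congr_fun polarCoord.open_target.measurableSet h1]
  simp only [polarCoord_target]
  rw [Measure.volume_eq_prod, ← Measure.prod_restrict,
    lintegral_prod_mul (f := (Set.Ici (√s)).indicator
      (fun r => ENNReal.ofReal (r * (Real.pi⁻¹ * Real.exp (-r ^ 2))))) (g := fun _ => 1)
    (Measurable.aemeasurable (Measurable.indicator (by fun_prop) measurableSet_Ici)) (by fun_prop)]
  have hae : (Set.Ici (√s) ∩ Set.Ioi 0 : Set ℝ) =ᵐ[volume] Set.Ioi (√s) := by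
    have h0 : (Set.Ioi (√s) ∩ Set.Ioi 0 : Set ℝ) = Set.Ioi (√s) :=
      Set.inter_eq_left.2 (Set.Ioi_subset_Ioi (Real.sqrt_nonneg s))
    conv_rhs => rw [← h0]
    exact Ioi_ae_eq_Ici.symm.inter (ae_eq_refl _)
  have hd : ∀ r ∈ Set.Ici (√s), HasDerivAt (fun r : ℝ => -(2 * Real.pi)⁻¹ * Real.exp (-r ^ 2))
      (r * (Real.pi⁻¹ * Real.exp (-r ^ 2))) r := by
    intro r _
    have := ((((hasDerivAt_id r).pow 2).neg).exp).const_mul (-(2 * Real.pi)⁻¹)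
    refine this.congr_deriv ?_
    simp only [id, Pi.pow_apply, Pi.neg_apply]
    field_simp
    simp
  have hlim : Filter.Tendsto (fun r : ℝ => -(2 * Real.pi)⁻¹ * Real.exp (-r ^ 2)) Filter.atTop
      (nhds 0) := by
    have : Filter.Tendsto (fun r : ℝ => Real.exp (-r ^ 2)) Filter.atTop (nhds 0) :=
      Real.tendsto_exp_neg_atTop_nhds_zero.comp (Filter.tendsto_pow_atTop two_ne_zero)
    simpa using this.const_mul (-(2 * Real.pi)⁻¹)
  have hpos : ∀ r ∈ Set.Ioi (√s), 0 ≤ r * (Real.pi⁻¹ * Real.exp (-r ^ 2)) := by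
    intro r hr
    have : 0 < r := (Real.sqrt_nonneg s).trans_lt hr
    positivity
  have hint := integrableOn_Ioi_deriv_of_nonneg' hd hpos hlim
  have hval := integral_Ioi_of_hasDerivAt_of_nonneg' hd hpos hlim
  rw [lintegral_indicator measurableSet_Ici, Measure.restrict_restrict measurableSet_Ici,
    setLIntegral_congr hae, ← ofReal_integral_eq_lintegral_ofReal hint
      ((ae_restrict_iff' measurableSet_Ioi).2 (Filter.Eventually.of_forall hpos)), hval]
  simp only [lintegral_const, one_mul, Measure.restrict_apply_univ, Real.volume_Ioo]
  rw [← ENNReal.ofReal_mul, Real.sq_sqrt hs]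
  · congr 1
    field_simp
    ring
  · have := Real.exp_pos (-√s ^ 2)
    have := Real.pi_pos
    simp only [zero_sub, neg_mul, neg_neg]
    positivity

/-! ### The uniform law from exponential variables -/

lemma eq_uniform_of_Iic (ν : Measure ℝ) [IsProbabilityMeasure ν]
    (h : ∀ z ∈ Set.Ioo (0 : ℝ) 1, ν (Set.Iic z) = ENNReal.ofReal z) :
    ν = volume.restrict (Set.Icc (0 : ℝ) 1) := by
  refine Measure.ext_of_Iic _ _ fun z => ?_
  rw [Measure.restrict_apply measurableSet_Iic]
  rcases lt_or_ge z 1 with h1 | h1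
  · rcases lt_or_ge 0 z with h0 | h0
    · have : Set.Iic z ∩ Set.Icc 0 1 = Set.Icc 0 z := by
        ext t; simp only [Set.mem_inter_iff, Set.mem_Iic, Set.mem_Icc]
        constructor
        · rintro ⟨a, b, c⟩; exact ⟨b, a⟩
        · rintro ⟨a, b⟩; exact ⟨b, a, by linarith⟩
      rw [this, h z ⟨h0, h1⟩]; simp
    · have e1 : volume (Set.Iic z ∩ Set.Icc (0 : ℝ) 1) = 0 := by
        refine measure_mono_null (t := {0}) ?_ (by simp)
        rintro t ⟨a, b, c⟩
        exact le_antisymm (le_trans a h0) b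
      rw [e1]
      refine le_antisymm (le_of_forall_gt_imp_ge_of_dense fun e he => ?_) zero_le
      obtain ⟨r, hr0, hr⟩ := ENNReal.lt_iff_exists_real_btwn.1 he
      have hr' : 0 < ENNReal.ofReal r := hr.1
      have hr'' : 0 < r := ENNReal.ofReal_pos.1 hr'
      have hm : min r (1 / 2) ∈ Set.Ioo (0 : ℝ) 1 :=
        ⟨by positivity, (min_le_right _ _).trans_lt (by norm_num)⟩
      calc ν (Set.Iic z) ≤ ν (Set.Iic (min r (1 / 2))) :=
            measure_mono (Set.Iic_subset_Iic.2 (h0.trans hm.1.le))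
        _ = ENNReal.ofReal (min r (1 / 2)) := h _ hm
        _ ≤ ENNReal.ofReal r := ENNReal.ofReal_le_ofReal (min_le_left _ _)
        _ ≤ e := hr.2.le
  · have e1 : Set.Iic z ∩ Set.Icc (0 : ℝ) 1 = Set.Icc 0 1 :=
      Set.inter_eq_right.2 fun t ht => ht.2.trans h1
    rw [e1, Real.volume_Icc, sub_zero, ENNReal.ofReal_one]
    refine le_antisymm prob_le_one (le_of_forall_lt_imp_le_of_dense fun e he => ?_)
    obtain ⟨r, hr0, hr⟩ := ENNReal.lt_iff_exists_real_btwn.1 he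
    have hr1 : r < 1 := by
      have := hr.2
      rwa [ENNReal.ofReal_lt_one] at this
    have hm : max r (1 / 2) ∈ Set.Ioo (0 : ℝ) 1 :=
      ⟨lt_max_of_lt_right (by norm_num), max_lt hr1 (by norm_num)⟩
    calc e ≤ ENNReal.ofReal r := hr.1.le
      _ ≤ ENNReal.ofReal (max r (1 / 2)) := ENNReal.ofReal_le_ofReal (le_max_left _ _)
      _ = ν (Set.Iic (max r (1 / 2))) := (h _ hm).symm
      _ ≤ ν (Set.Iic z) := measure_mono (Set.Iic_subset_Iic.2 (hm.2.le.trans h1))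

lemma lintegral_exp_neg_mul_norm_sq_stdComplexGaussian {c : ℝ} (hc : 0 ≤ c) :
    ∫⁻ x, ENNReal.ofReal (Real.exp (-(c * ‖x‖ ^ 2))) ∂stdComplexGaussian
      = ENNReal.ofReal (1 + c)⁻¹ := by
  rw [stdComplexGaussian_eq_withDensity, lintegral_withDensity_eq_lintegral_mul _ (by fun_prop)
    (by fun_prop)]
  have h1 : ∀ x : ℂ, ((fun z : ℂ => ENNReal.ofReal (Real.pi⁻¹ * Real.exp (-‖z‖ ^ 2))) *
      (fun x : ℂ => ENNReal.ofReal (Real.exp (-(c * ‖x‖ ^ 2))))) x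
      = ENNReal.ofReal (Real.pi⁻¹ * Real.exp (-(1 + c) * ‖x‖ ^ 2)) := by
    intro x
    have := Real.pi_pos
    simp only [Pi.mul_apply]
    rw [← ENNReal.ofReal_mul (by positivity), mul_assoc, ← Real.exp_add]
    ring_nf
  have h2 : ∫ x : ℂ, Real.exp (-(1 + c) * ‖x‖ ^ 2) = Real.pi / (1 + c) := by
    rw [GaussianFourier.integral_rexp_neg_mul_sq_norm (by linarith)]
    simp
  have h3 : Integrable (fun x : ℂ => Real.exp (-(1 + c) * ‖x‖ ^ 2)) := by
    refine Integrable.of_integral_ne_zero ?_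
    rw [h2]
    have := Real.pi_pos
    positivity
  simp_rw [h1]
  rw [← ofReal_integral_eq_lintegral_ofReal (h3.const_mul _)
    (Filter.Eventually.of_forall fun x => by have := Real.pi_pos; positivity),
    integral_const_mul, h2]
  congr 1
  have := Real.pi_pos
  field_simp

/-- The squared Euclidean norm of a vector of `ℂ²`. -/
noncomputable def sqNorm (u : Fin 2 → ℂ) : ℝ := ‖u 0‖ ^ 2 + ‖u 1‖ ^ 2

lemma sqNorm_nonneg (u : Fin 2 → ℂ) : 0 ≤ sqNorm u := by unfold sqNorm; positivity

lemma measurable_sqNorm : Measurable sqNorm := by unfold sqNorm; fun_prop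

/-- The share of one coordinate in the squared norm of a standard complex Gaussian vector of `ℂ²`
is uniform: it is `E₁ / (E₁ + E₂)` for independent exponential variables of rate `1`. -/
lemma map_coord_div_sqNorm (j : Fin 2) :
    (Measure.pi fun _ : Fin 2 => stdComplexGaussian).map (fun g => ‖g j‖ ^ 2 / sqNorm g)
      = volume.restrict (Set.Icc (0 : ℝ) 1) := by
  have hmeas : ∀ j : Fin 2, Measurable (fun g : Fin 2 → ℂ => ‖g j‖ ^ 2 / sqNorm g) := fun j =>
    Measurable.div (by fun_prop) measurable_sqNorm
  have h0 : (Measure.pi fun _ : Fin 2 => stdComplexGaussian).map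
      (fun g => ‖g 0‖ ^ 2 / sqNorm g) = volume.restrict (Set.Icc (0 : ℝ) 1) := by
    have : IsProbabilityMeasure ((Measure.pi fun _ : Fin 2 => stdComplexGaussian).map
      (fun g => ‖g 0‖ ^ 2 / sqNorm g)) :=
        Measure.isProbabilityMeasure_map (hmeas 0).aemeasurable
    refine eq_uniform_of_Iic _ fun z hz => ?_
    have hz0 : 0 < z := hz.1
    have hz1 : 0 < 1 - z := sub_pos.2 hz.2
    rw [Measure.map_apply (hmeas 0) measurableSet_Iic]
    have hset : (fun g : Fin 2 → ℂ => ‖g 0‖ ^ 2 / sqNorm g) ⁻¹' Set.Iic z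
        = MeasurableEquiv.finTwoArrow ⁻¹'
          {p : ℂ × ℂ | (1 - z) / z * ‖p.1‖ ^ 2 ≤ ‖p.2‖ ^ 2} := by
      ext g
      simp only [Set.mem_preimage, Set.mem_Iic, Set.mem_ofPred_eq]
      change ‖g 0‖ ^ 2 / sqNorm g ≤ z ↔ (1 - z) / z * ‖g 0‖ ^ 2 ≤ ‖g 1‖ ^ 2
      rw [div_mul_eq_mul_div, div_le_iff₀ hz0]
      rcases (sqNorm_nonneg g).eq_or_lt with h | h
      · rw [← h]
        unfold sqNorm at h
        have h0 : ‖g 0‖ ^ 2 = 0 := by nlinarith [sq_nonneg ‖g 0‖, sq_nonneg ‖g 1‖]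
        have h1 : ‖g 1‖ ^ 2 = 0 := by nlinarith [sq_nonneg ‖g 0‖, sq_nonneg ‖g 1‖]
        simp [h0, h1, hz0.le]
      · rw [div_le_iff₀ h]
        unfold sqNorm
        constructor <;> intro h <;> linarith
    have hms : MeasurableSet {p : ℂ × ℂ | (1 - z) / z * ‖p.1‖ ^ 2 ≤ ‖p.2‖ ^ 2} :=
      measurableSet_le (by fun_prop) (by fun_prop)
    rw [hset, (measurePreserving_finTwoArrow stdComplexGaussian).measure_preimage
      hms.nullMeasurableSet, Measure.prod_apply hms]
    have : ∀ x : ℂ, stdComplexGaussian (Prod.mk x ⁻¹'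
        {p : ℂ × ℂ | (1 - z) / z * ‖p.1‖ ^ 2 ≤ ‖p.2‖ ^ 2})
        = ENNReal.ofReal (Real.exp (-((1 - z) / z * ‖x‖ ^ 2))) := fun x => by
      have h := stdComplexGaussian_le_norm_sq (s := (1 - z) / z * ‖x‖ ^ 2) (by positivity)
      exact h ▸ congrArg _ (by ext y; simp)
    simp_rw [this]
    rw [lintegral_exp_neg_mul_norm_sq_stdComplexGaussian (by positivity)]
    congr 1
    field_simp
    ring
  fin_cases j
  · exact h0
  · have hs := measurePreserving_gaussian_of_sum_norm_sq
      (LinearMap.funLeft ℝ ℂ (Equiv.swap (0 : Fin 2) 1)) (fun z => by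
        simp [LinearMap.funLeft_apply, Fin.sum_univ_two, add_comm])
    rw [← h0]
    nth_rewrite 1 [← hs.map_eq]
    rw [Measure.map_map (hmeas _) hs.measurable]
    congr 1
    ext g
    simp [LinearMap.funLeft_apply, sqNorm, add_comm]

lemma ae_gaussian_norm_ne :
    ∀ᵐ g ∂(Measure.pi fun _ : Fin 2 => stdComplexGaussian), ‖g 0‖ ^ 2 ≠ ‖g 1‖ ^ 2 := by
  -- Equal moduli force the uniform variable `|g₀|² / |g|²` to be `1/2`, or `0 / 0 = 0`.
  have hm : Measurable (fun g : Fin 2 → ℂ => ‖g 0‖ ^ 2 / sqNorm g) :=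
    Measurable.div (by fun_prop) measurable_sqNorm
  have h : ∀ᵐ t ∂(volume.restrict (Set.Icc (0 : ℝ) 1)), t ∉ ({0, 1 / 2} : Set ℝ) :=
    ae_restrict_of_ae (Set.Countable.ae_notMem (by simp) _)
  rw [← map_coord_div_sqNorm 0] at h
  filter_upwards [ae_of_ae_map hm.aemeasurable h] with g hg heq
  apply hg
  unfold sqNorm
  rw [← heq]
  rcases eq_or_ne (‖g 0‖ ^ 2) 0 with h0 | h0
  · simp [h0]
  · right
    rw [Set.mem_singleton_iff, ← two_mul, div_eq_div_iff (by positivity) two_ne_zero]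
    ring

/-! ### Singular vectors of `2 × 2` matrices -/

lemma ofReal_sqNorm (u : Fin 2 → ℂ) : ((sqNorm u : ℝ) : ℂ) = star u ⬝ᵥ u := by
  simp only [sqNorm, dotProduct, Fin.sum_univ_two, Pi.star_apply, RCLike.star_def,
    Complex.conj_mul']
  push_cast
  rfl

lemma sqNorm_mulVec_of_mem_unitaryGroup {T : Matrix (Fin 2) (Fin 2) ℂ}
    (hT : T ∈ Matrix.unitaryGroup (Fin 2) ℂ) (u : Fin 2 → ℂ) : sqNorm (T *ᵥ u) = sqNorm u := by
  have h : Tᴴ * T = 1 := Matrix.mem_unitaryGroup_iff'.1 hT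
  apply Complex.ofReal_injective
  rw [ofReal_sqNorm, ofReal_sqNorm, Matrix.star_mulVec, Matrix.dotProduct_mulVec,
    Matrix.vecMul_vecMul, h, Matrix.vecMul_one]

lemma conjTranspose_mem_unitaryGroup {T : Matrix (Fin 2) (Fin 2) ℂ}
    (hT : T ∈ Matrix.unitaryGroup (Fin 2) ℂ) : Tᴴ ∈ Matrix.unitaryGroup (Fin 2) ℂ :=
  Unitary.star_mem hT

/-- The squared Frobenius norm. -/
noncomputable def frobSq (M : Matrix (Fin 2) (Fin 2) ℂ) : ℝ := ∑ a, ∑ b, ‖M a b‖ ^ 2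

lemma ofReal_frobSq (M : Matrix (Fin 2) (Fin 2) ℂ) :
    ((frobSq M : ℝ) : ℂ) = (M * Mᴴ).trace := by
  simp only [frobSq, Matrix.trace, Matrix.diag, Matrix.mul_apply, Matrix.conjTranspose_apply,
    RCLike.star_def, Complex.mul_conj']
  push_cast
  rfl

lemma frobSq_mul_of_mem_unitaryGroup {T : Matrix (Fin 2) (Fin 2) ℂ}
    (hT : T ∈ Matrix.unitaryGroup (Fin 2) ℂ) (M : Matrix (Fin 2) (Fin 2) ℂ) :
    frobSq (M * T) = frobSq M := by
  have h : T * Tᴴ = 1 := Matrix.mem_unitaryGroup_iff.1 hT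
  apply Complex.ofReal_injective
  rw [ofReal_frobSq, ofReal_frobSq, Matrix.conjTranspose_mul, Matrix.mul_assoc,
    ← Matrix.mul_assoc T, h, Matrix.one_mul]

lemma frobSq_conjTranspose (M : Matrix (Fin 2) (Fin 2) ℂ) : frobSq Mᴴ = frobSq M := by
  simp only [frobSq, Matrix.conjTranspose_apply, norm_star]
  exact Finset.sum_comm

lemma norm_det_of_mem_unitaryGroup {T : Matrix (Fin 2) (Fin 2) ℂ}
    (hT : T ∈ Matrix.unitaryGroup (Fin 2) ℂ) : ‖T.det‖ = 1 :=
  CStarRing.norm_of_mem_unitary (Matrix.det_of_mem_unitary hT)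

/-- The squared modulus `|v† u|²`, where `v` is a unit right singular vector of `M` for the larger
(`s = 1`) or the smaller (`s = -1`) singular value, as an explicit and hence measurable function of
`M` and `u`. The eigenvalue gap of `Mᴴ * M` is the square root of the discriminant of its
characteristic polynomial, and its spectral projections are affine functions of `Mᴴ * M` divided by
this gap. The value is meaningful only if the two singular values are distinct: otherwise the gap
vanishes and the division by it gives `0`. -/
noncomputable def spectralGain (s : ℝ) (M : Matrix (Fin 2) (Fin 2) ℂ) (u : Fin 2 → ℂ) : ℝ :=
  (sqNorm u + s * (2 * sqNorm (M *ᵥ u) - frobSq M * sqNorm u)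
    / √(frobSq M ^ 2 - 4 * ‖M.det‖ ^ 2)) / 2

lemma spectralGain_mul {T : Matrix (Fin 2) (Fin 2) ℂ}
    (hT : T ∈ Matrix.unitaryGroup (Fin 2) ℂ) (s : ℝ) (M : Matrix (Fin 2) (Fin 2) ℂ)
    (u : Fin 2 → ℂ) : spectralGain s (M * T) u = spectralGain s M (T *ᵥ u) := by
  simp only [spectralGain, frobSq_mul_of_mem_unitaryGroup hT, sqNorm_mulVec_of_mem_unitaryGroup hT,
    Matrix.det_mul, norm_mul, norm_det_of_mem_unitaryGroup hT, mul_one, Matrix.mulVec_mulVec]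

lemma sqNorm_smul (c : ℂ) (u : Fin 2 → ℂ) : sqNorm (c • u) = ‖c‖ ^ 2 * sqNorm u := by
  simp only [sqNorm, Pi.smul_apply, smul_eq_mul, norm_mul]
  ring

lemma spectralGain_smul (s : ℝ) (M : Matrix (Fin 2) (Fin 2) ℂ) (c : ℂ) (u : Fin 2 → ℂ) :
    spectralGain s M (c • u) = ‖c‖ ^ 2 * spectralGain s M u := by
  simp only [spectralGain, Matrix.mulVec_smul, sqNorm_smul]
  ring

/-- The sign that selects the `j`-th singular value, in decreasing order. -/
def singularSign (j : Fin 2) : ℝ := ![1, -1] j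

namespace IsOrderedSVD

variable {M U V : Matrix (Fin 2) (Fin 2) ℂ} {lam : Fin 2 → ℝ}

lemma conjTranspose (h : IsOrderedSVD M U lam V) : IsOrderedSVD Mᴴ V lam U where
  left_unitary := h.right_unitary
  right_unitary := h.left_unitary
  nonneg := h.nonneg
  ordered := h.ordered
  eq_mul := by
    rw [h.eq_mul, Matrix.conjTranspose_mul, Matrix.conjTranspose_mul,
      Matrix.conjTranspose_conjTranspose, Matrix.diagonal_conjTranspose, ← Matrix.mul_assoc]
    congr 3
    ext k
    simp

lemma nonneg' (h : IsOrderedSVD M U lam V) (k : Fin 2) : 0 ≤ lam k := by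
  fin_cases k
  · exact h.nonneg.trans h.ordered
  · exact h.nonneg

lemma conjTranspose_mulVec_apply (V : Matrix (Fin 2) (Fin 2) ℂ) (u : Fin 2 → ℂ) (k : Fin 2) :
    (Vᴴ *ᵥ u) k = star (V.col k) ⬝ᵥ u := rfl

lemma sqNorm_eq (h : IsOrderedSVD M U lam V) (u : Fin 2 → ℂ) :
    sqNorm u = ‖star (V.col 0) ⬝ᵥ u‖ ^ 2 + ‖star (V.col 1) ⬝ᵥ u‖ ^ 2 := by
  rw [← sqNorm_mulVec_of_mem_unitaryGroup (conjTranspose_mem_unitaryGroup h.right_unitary) u]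
  rfl

lemma sqNorm_mulVec (h : IsOrderedSVD M U lam V) (u : Fin 2 → ℂ) :
    sqNorm (M *ᵥ u)
      = lam 0 * ‖star (V.col 0) ⬝ᵥ u‖ ^ 2 + lam 1 * ‖star (V.col 1) ⬝ᵥ u‖ ^ 2 := by
  rw [h.eq_mul, ← Matrix.mulVec_mulVec, ← Matrix.mulVec_mulVec,
    sqNorm_mulVec_of_mem_unitaryGroup h.left_unitary]
  simp only [sqNorm, Matrix.mulVec_diagonal, conjTranspose_mulVec_apply, norm_mul, mul_pow,
    Complex.norm_real, Real.norm_eq_abs, sq_abs, Real.sq_sqrt (h.nonneg' _)]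

lemma sqNorm_col (h : IsOrderedSVD M U lam V) (k : Fin 2) : sqNorm (V.col k) = 1 := by
  have h1 := sqNorm_mulVec_of_mem_unitaryGroup h.right_unitary (Pi.single k 1)
  rw [Matrix.mulVec_single_one] at h1
  rw [h1]
  fin_cases k <;> simp [sqNorm]

lemma frobSq_eq (h : IsOrderedSVD M U lam V) : frobSq M = lam 0 + lam 1 := by
  have h1 : frobSq M = sqNorm (M *ᵥ Pi.single 0 1) + sqNorm (M *ᵥ Pi.single 1 1) := by
    simp only [frobSq, sqNorm, Fin.sum_univ_two, Matrix.mulVec_single_one, Matrix.col_apply]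
    ring
  have h2 := h.sqNorm_col 0
  have h3 := h.sqNorm_col 1
  rw [h1, h.sqNorm_mulVec, h.sqNorm_mulVec]
  simp only [dotProduct_single_one, Pi.star_apply, norm_star]
  unfold sqNorm at h2 h3
  linear_combination lam 0 * h2 + lam 1 * h3

lemma norm_det_sq (h : IsOrderedSVD M U lam V) : ‖M.det‖ ^ 2 = lam 0 * lam 1 := by
  rw [h.eq_mul, Matrix.det_mul, Matrix.det_mul, norm_mul, norm_mul,
    norm_det_of_mem_unitaryGroup h.left_unitary,
    norm_det_of_mem_unitaryGroup (conjTranspose_mem_unitaryGroup h.right_unitary),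
    Matrix.det_diagonal, Fin.prod_univ_two]
  simp only [norm_mul, mul_pow, Complex.norm_real, Real.norm_eq_abs, sq_abs,
    Real.sq_sqrt (h.nonneg' _), one_mul, mul_one]

/-- The explicit formula for the spectral projections agrees with every singular value
decomposition, provided that the singular values are distinct. -/
lemma spectralGain_eq (h : IsOrderedSVD M U lam V) (hne : lam 1 ≠ lam 0) (j : Fin 2)
    (u : Fin 2 → ℂ) :
    spectralGain (singularSign j) M u = ‖star (V.col j) ⬝ᵥ u‖ ^ 2 := by
  have hpos : 0 < lam 0 - lam 1 := sub_pos.2 (lt_of_le_of_ne h.ordered hne)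
  have hd : √(frobSq M ^ 2 - 4 * ‖M.det‖ ^ 2) = lam 0 - lam 1 := by
    rw [h.frobSq_eq, h.norm_det_sq, ← Real.sqrt_sq hpos.le]
    congr 1
    ring
  unfold spectralGain
  rw [hd, h.sqNorm_mulVec, h.frobSq_eq, h.sqNorm_eq u]
  have hpos' := hpos.ne'
  fin_cases j <;> simp [singularSign] <;> field_simp <;> ring

/-- A `2 × 2` matrix with equal singular values is a multiple of a unitary matrix, so its diagonal
entries have the same modulus. -/
lemma norm_diag_eq (h : IsOrderedSVD M U lam V) (heq : lam 1 = lam 0) :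
    ‖M 0 0‖ ^ 2 = ‖M 1 1‖ ^ 2 := by
  have hr : sqNorm (Mᴴ *ᵥ Pi.single 1 1) = lam 0 := by
    rw [h.conjTranspose.sqNorm_mulVec, heq, ← mul_add, ← h.conjTranspose.sqNorm_eq]
    simp [sqNorm]
  have hc : sqNorm (M *ᵥ Pi.single 0 1) = lam 0 := by
    rw [h.sqNorm_mulVec, heq, ← mul_add, ← h.sqNorm_eq]
    simp [sqNorm]
  simp only [sqNorm, Matrix.mulVec_single_one, Matrix.col_apply, Matrix.conjTranspose_apply,
    norm_star] at hr hc
  linarith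

end IsOrderedSVD

/-! ### Projections of singular vectors of a Gaussian matrix -/

/-- The law of the four entries of a `2 × 2` matrix with independent `CN(0,1)` entries. -/
noncomputable def gaussianEntries : Measure (Fin 2 × Fin 2 → ℂ) :=
  Measure.pi fun _ => stdComplexGaussian

/-- The matrix with the given family of entries. -/
def matrixOfEntries (z : Fin 2 × Fin 2 → ℂ) : Matrix (Fin 2) (Fin 2) ℂ :=
  Matrix.of fun a b => z (a, b)

/-- The family of entries of a matrix. -/
def entriesOfMatrix (M : Matrix (Fin 2) (Fin 2) ℂ) : Fin 2 × Fin 2 → ℂ := fun p => M p.1 p.2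

lemma matrixOfEntries_entriesOfMatrix (M : Matrix (Fin 2) (Fin 2) ℂ) :
    matrixOfEntries (entriesOfMatrix M) = M := rfl

instance : IsProbabilityMeasure gaussianEntries := by unfold gaussianEntries; infer_instance

lemma frobSq_matrixOfEntries (z : Fin 2 × Fin 2 → ℂ) :
    frobSq (matrixOfEntries z) = ∑ p, ‖z p‖ ^ 2 := by
  rw [Fintype.sum_prod_type]
  rfl

lemma measurable_spectralGain (s : ℝ) :
    Measurable (fun p : (Fin 2 × Fin 2 → ℂ) × (Fin 2 → ℂ) =>
      spectralGain s (matrixOfEntries p.1) p.2) := by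
  simp only [spectralGain, sqNorm, frobSq, matrixOfEntries, Matrix.det_fin_two, Matrix.mulVec,
    dotProduct, Fin.sum_univ_two, Matrix.of_apply]
  fun_prop

lemma measurable_spectralGain_left (s : ℝ) (u : Fin 2 → ℂ) :
    Measurable (fun z : Fin 2 × Fin 2 → ℂ => spectralGain s (matrixOfEntries z) u) := by
  have h : Measurable (fun z : Fin 2 × Fin 2 → ℂ => (z, u)) := by fun_prop
  simpa only [Function.comp_def] using (measurable_spectralGain s).comp h

lemma measurePreserving_mulVec {T : Matrix (Fin 2) (Fin 2) ℂ}
    (hT : T ∈ Matrix.unitaryGroup (Fin 2) ℂ) :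
    MeasurePreserving (fun g => T *ᵥ g) (Measure.pi fun _ : Fin 2 => stdComplexGaussian)
      (Measure.pi fun _ : Fin 2 => stdComplexGaussian) :=
  measurePreserving_gaussian_of_sum_norm_sq (T.mulVecLin.restrictScalars ℝ) fun z => by
    simpa [sqNorm, Fin.sum_univ_two] using sqNorm_mulVec_of_mem_unitaryGroup hT z

lemma measurePreserving_mul_right {T : Matrix (Fin 2) (Fin 2) ℂ}
    (hT : T ∈ Matrix.unitaryGroup (Fin 2) ℂ) :
    MeasurePreserving (fun z => entriesOfMatrix (matrixOfEntries z * T)) gaussianEntries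
      gaussianEntries := by
  let e : (Fin 2 × Fin 2 → ℂ) →ₗ[ℝ] (Fin 2 × Fin 2 → ℂ) :=
    { toFun := fun z => entriesOfMatrix (matrixOfEntries z * T)
      map_add' := fun x y => by
        ext p
        simp [entriesOfMatrix, matrixOfEntries, Matrix.mul_apply, add_mul, Finset.sum_add_distrib]
      map_smul' := fun c x => by
        ext p
        simp [entriesOfMatrix, matrixOfEntries, Matrix.mul_apply, mul_assoc] }
  refine measurePreserving_gaussian_of_sum_norm_sq e fun z => ?_
  rw [← frobSq_matrixOfEntries, ← frobSq_matrixOfEntries]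
  exact frobSq_mul_of_mem_unitaryGroup hT _

lemma measurePreserving_conjTranspose :
    MeasurePreserving (fun z => entriesOfMatrix (matrixOfEntries z)ᴴ) gaussianEntries
      gaussianEntries := by
  let e : (Fin 2 × Fin 2 → ℂ) →ₗ[ℝ] (Fin 2 × Fin 2 → ℂ) :=
    { toFun := fun z => entriesOfMatrix (matrixOfEntries z)ᴴ
      map_add' := fun x y => by
        ext p
        simp [entriesOfMatrix, matrixOfEntries]
      map_smul' := fun c x => by
        ext p
        simp [entriesOfMatrix, matrixOfEntries] }
  refine measurePreserving_gaussian_of_sum_norm_sq e fun z => ?_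
  rw [← frobSq_matrixOfEntries, ← frobSq_matrixOfEntries]
  exact frobSq_conjTranspose _

lemma ae_gaussianEntries_norm_diag_ne :
    ∀ᵐ z ∂gaussianEntries, ‖z (0, 0)‖ ^ 2 ≠ ‖z (1, 1)‖ ^ 2 := by
  have hind : iIndepFun (fun (k : Fin 2) (z : Fin 2 × Fin 2 → ℂ) => z (k, k)) gaussianEntries :=
    (iIndepFun_pi (μ := fun _ : Fin 2 × Fin 2 => stdComplexGaussian) (X := fun _ => id)
      (fun _ => aemeasurable_id)).precomp (g := fun k : Fin 2 => (k, k))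
      (fun a b h => (Prod.ext_iff.1 h).1)
  rw [iIndepFun_iff_map_fun_eq_pi_map fun k => (measurable_pi_apply (k, k)).aemeasurable] at hind
  have hk : ∀ k : Fin 2, gaussianEntries.map (fun z => z (k, k)) = stdComplexGaussian := fun k =>
    (measurePreserving_eval (fun _ : Fin 2 × Fin 2 => stdComplexGaussian) (k, k)).map_eq
  simp_rw [hk] at hind
  have := ae_gaussian_norm_ne
  rw [← hind] at this
  exact ae_of_ae_map (f := fun z : Fin 2 × Fin 2 → ℂ => fun k : Fin 2 => z (k, k))
    (Measurable.aemeasurable (by fun_prop)) this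

section

variable {Ω : Type*} [MeasurableSpace Ω] {μ : Measure Ω}

lemma IsIIDGaussianMatrix.hasLaw_entries [IsProbabilityMeasure μ]
    {G : Ω → Matrix (Fin 2) (Fin 2) ℂ} (hG : IsIIDGaussianMatrix μ G) :
    HasLaw (fun x => entriesOfMatrix (G x)) gaussianEntries μ where
  aemeasurable := aemeasurable_pi_lambda _ fun p => (hG.hasLaw_entry p.1 p.2).aemeasurable
  map_eq := by
    have h := hG.indep_entries
    rw [iIndepFun_iff_map_fun_eq_pi_map
      fun p : Fin 2 × Fin 2 => (hG.hasLaw_entry p.1 p.2).aemeasurable] at h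
    simp_rw [fun p : Fin 2 × Fin 2 => (hG.hasLaw_entry p.1 p.2).map_eq] at h
    exact h

lemma hasLaw_conjTranspose_entries {G : Ω → Matrix (Fin 2) (Fin 2) ℂ}
    (hG : HasLaw (fun x => entriesOfMatrix (G x)) gaussianEntries μ) :
    HasLaw (fun x => entriesOfMatrix (G x)ᴴ) gaussianEntries μ where
  aemeasurable := measurePreserving_conjTranspose.measurable.comp_aemeasurable hG.aemeasurable
  map_eq := by
    rw [← measurePreserving_conjTranspose.map_eq, ← hG.map_eq,
      AEMeasurable.map_map_of_aemeasurable
        measurePreserving_conjTranspose.measurable.aemeasurable hG.aemeasurable]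
    rfl

/-- Almost surely the singular values are distinct, so that the singular vectors are unique up to
phases and `spectralGain` computes their projections. -/
lemma ae_spectralGain_eq {G U V : Ω → Matrix (Fin 2) (Fin 2) ℂ} {lam : Ω → Fin 2 → ℝ}
    (hG : HasLaw (fun x => entriesOfMatrix (G x)) gaussianEntries μ)
    (hsvd : ∀ᵐ x ∂μ, IsOrderedSVD (G x) (U x) (lam x) (V x)) :
    ∀ᵐ x ∂μ, ∀ j u,
      spectralGain (singularSign j) (G x) u = ‖star ((V x).col j) ⬝ᵥ u‖ ^ 2 := by
  have h := ae_gaussianEntries_norm_diag_ne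
  rw [← hG.map_eq] at h
  filter_upwards [hsvd, ae_of_ae_map hG.aemeasurable h] with x hx hne
  exact fun j u => hx.spectralGain_eq (fun heq => hne (hx.norm_diag_eq heq)) j u

end

/-- Some unitary matrix has a given unit vector as its first column. -/
lemma exists_unitary_mulVec_single {u : Fin 2 → ℂ} (hu : sqNorm u = 1) :
    ∃ T ∈ Matrix.unitaryGroup (Fin 2) ℂ, T *ᵥ Pi.single 0 1 = u := by
  refine ⟨!![u 0, -star (u 1); u 1, star (u 0)], ?_, ?_⟩
  · rw [Matrix.mem_unitaryGroup_iff']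
    have h1 : star (u 0) * u 0 + star (u 1) * u 1 = 1 := by
      have := ofReal_sqNorm u
      rw [hu] at this
      simpa [dotProduct, Fin.sum_univ_two] using this.symm
    ext a b
    fin_cases a <;> fin_cases b <;>
      simp [Matrix.mul_apply, Fin.sum_univ_two, Matrix.star_apply] at h1 ⊢ <;>
      first | linear_combination h1 | ring
  · rw [Matrix.mulVec_single_one]
    ext k
    fin_cases k <;> simp

lemma map_spectralGain_eq_of_sqNorm_eq_one (s : ℝ) {u : Fin 2 → ℂ} (hu : sqNorm u = 1) :
    gaussianEntries.map (fun z => spectralGain s (matrixOfEntries z) u)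
      = gaussianEntries.map (fun z => spectralGain s (matrixOfEntries z) (Pi.single 0 1)) := by
  obtain ⟨T, hT, rfl⟩ := exists_unitary_mulVec_single hu
  have hmp := measurePreserving_mul_right hT
  conv_rhs => rw [← hmp.map_eq]
  rw [Measure.map_map (measurable_spectralGain_left s _) hmp.measurable]
  congr 1
  ext z
  exact (spectralGain_mul hT s _ _).symm

/-- The squared modulus of the projection of a singular vector onto a fixed unit vector is uniform
on `[0, 1]`. By unitary invariance its law is the same for all unit vectors, so it does not change
when the unit vector is replaced by an independent random direction `g / |g|`, with `g` Gaussian.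
For a fixed matrix, `|v† g|² / |g|²` is a coordinate share of the Gaussian vector `Vᴴ g`. -/
lemma map_spectralGain {Ω : Type*} [MeasurableSpace Ω] {μ : Measure Ω} [IsProbabilityMeasure μ]
    {G U V : Ω → Matrix (Fin 2) (Fin 2) ℂ} {lam : Ω → Fin 2 → ℝ}
    (hG : HasLaw (fun x => entriesOfMatrix (G x)) gaussianEntries μ)
    (hsvd : ∀ᵐ x ∂μ, IsOrderedSVD (G x) (U x) (lam x) (V x)) (j : Fin 2)
    {u : Fin 2 → ℂ} (hu : sqNorm u = 1) :
    gaussianEntries.map (fun z => spectralGain (singularSign j) (matrixOfEntries z) u)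
      = volume.restrict (Set.Icc (0 : ℝ) 1) := by
  rw [map_spectralGain_eq_of_sqNorm_eq_one _ hu]
  set s := singularSign j
  set γ₂ := Measure.pi fun _ : Fin 2 => stdComplexGaussian with hγ₂
  ext B hB
  have hF : Measurable (fun p : (Fin 2 × Fin 2 → ℂ) × (Fin 2 → ℂ) =>
      spectralGain s (matrixOfEntries p.1) p.2 / sqNorm p.2) :=
    (measurable_spectralGain s).div (measurable_sqNorm.comp measurable_snd)
  have hS := hF hB
  have hu1 : ∀ v : Fin 2 → ℂ, Measurable (fun z => spectralGain s (matrixOfEntries z) v) :=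
    measurable_spectralGain_left s
  -- Integrating over the Gaussian vector first, for a fixed matrix, gives the uniform law.
  have h1 : (gaussianEntries.prod γ₂) ((fun p : (Fin 2 × Fin 2 → ℂ) × (Fin 2 → ℂ) =>
      spectralGain s (matrixOfEntries p.1) p.2 / sqNorm p.2) ⁻¹' B)
      = volume.restrict (Set.Icc (0 : ℝ) 1) B := by
    rw [Measure.prod_apply hS, ← hG.map_eq,
      lintegral_map' (measurable_measure_prodMk_left hS).aemeasurable hG.aemeasurable]
    have hae : ∀ᵐ x ∂μ, γ₂ (Prod.mk (entriesOfMatrix (G x)) ⁻¹'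
        ((fun p : (Fin 2 × Fin 2 → ℂ) × (Fin 2 → ℂ) =>
          spectralGain s (matrixOfEntries p.1) p.2 / sqNorm p.2) ⁻¹' B))
        = volume.restrict (Set.Icc (0 : ℝ) 1) B := by
      filter_upwards [hsvd, ae_spectralGain_eq hG hsvd] with x hx hg
      have hT := conjTranspose_mem_unitaryGroup hx.right_unitary
      have hmp := measurePreserving_mulVec hT
      have hm : Measurable (fun g : Fin 2 → ℂ => ‖g j‖ ^ 2 / sqNorm g) :=
        Measurable.div (by fun_prop) measurable_sqNorm
      rw [← map_coord_div_sqNorm j, Measure.map_apply hm hB, ← hγ₂,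
        ← hmp.measure_preimage (hm hB).nullMeasurableSet]
      congr 1
      ext g
      simp only [Set.mem_preimage, matrixOfEntries_entriesOfMatrix, s, hg,
        sqNorm_mulVec_of_mem_unitaryGroup hT, IsOrderedSVD.conjTranspose_mulVec_apply]
    rw [lintegral_congr_ae hae]
    simp
  rw [← h1, Measure.prod_apply_symm hS]
  -- Integrating over the matrix first, for a fixed direction, gives the law at the basis vector.
  have hae : ∀ᵐ g ∂γ₂, gaussianEntries ((fun z => (z, g)) ⁻¹'
      ((fun p : (Fin 2 × Fin 2 → ℂ) × (Fin 2 → ℂ) =>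
        spectralGain s (matrixOfEntries p.1) p.2 / sqNorm p.2) ⁻¹' B))
      = gaussianEntries.map
        (fun z => spectralGain s (matrixOfEntries z) (Pi.single 0 1)) B := by
    filter_upwards [ae_gaussian_norm_ne] with g hg
    have hpos : 0 < sqNorm g := by
      refine lt_of_le_of_ne (sqNorm_nonneg g) fun h => hg ?_
      unfold sqNorm at h
      nlinarith [sq_nonneg ‖g 0‖, sq_nonneg ‖g 1‖]
    have hc : ‖(((√(sqNorm g))⁻¹ : ℝ) : ℂ)‖ ^ 2 = (sqNorm g)⁻¹ := by
      rw [Complex.norm_real, Real.norm_eq_abs, sq_abs, inv_pow, Real.sq_sqrt hpos.le]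
    have hunit : sqNorm ((((√(sqNorm g))⁻¹ : ℝ) : ℂ) • g) = 1 := by
      rw [sqNorm_smul, hc, inv_mul_cancel₀ hpos.ne']
    rw [← map_spectralGain_eq_of_sqNorm_eq_one s hunit, Measure.map_apply (hu1 _) hB]
    congr 1
    ext z
    simp only [Set.mem_preimage, spectralGain_smul, hc, div_eq_inv_mul]
  rw [lintegral_congr_ae hae]
  simp

/-! ### The distribution function of the compensated gain -/

lemma hasDerivAt_arcsin_sqrt_sub {a : ℝ} (h0 : 0 < a) (h1 : a < 1) :
    HasDerivAt (fun a : ℝ => (Real.arcsin √a - (1 - 2 * a) * √(a * (1 - a))) / 4)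
      √(a * (1 - a)) a := by
  have h1' : 0 < 1 - a := sub_pos.2 h1
  have hs1 : √a < 1 := by rw [Real.sqrt_lt' one_pos]; simpa using h1
  have hA : HasDerivAt (fun a : ℝ => Real.arcsin √a) (1 / √(1 - √a ^ 2) * (1 / (2 * √a))) a :=
    (Real.hasDerivAt_arcsin (by linarith [Real.sqrt_nonneg a]) hs1.ne).comp a
      (Real.hasDerivAt_sqrt h0.ne')
  have hP : HasDerivAt (fun a : ℝ => a * (1 - a)) (1 * (1 - a) + a * (-1)) a :=
    (hasDerivAt_id a).mul ((hasDerivAt_id a).const_sub 1)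
  have hS := hP.sqrt (mul_pos h0 h1').ne'
  have hL : HasDerivAt (fun a : ℝ => 1 - 2 * a) (-(2 * 1)) a :=
    ((hasDerivAt_id a).const_mul 2).const_sub 1
  refine ((hA.sub (hL.mul hS)).div_const 4).congr_deriv ?_
  rw [Real.sq_sqrt h0.le, Real.sqrt_mul h0.le]
  have e1 := Real.sq_sqrt h0.le
  have e2 := Real.sq_sqrt h1'.le
  have p1 := Real.sqrt_pos.2 h0
  have p2 := Real.sqrt_pos.2 h1'
  set p := √a
  set q := √(1 - a)
  field_simp
  rw [← e2, ← e1]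
  have e3 : q ^ 2 = 1 - p ^ 2 := by rw [e1, e2]
  rw [e3]
  ring

lemma volume_sqrt_le {m : ℝ} (hm : m ≤ 1) :
    volume {b ∈ Set.Icc (0 : ℝ) 1 | √b ≤ m} = ENNReal.ofReal (max 0 m ^ 2) := by
  rcases lt_or_ge m 0 with h | h
  · have : {b ∈ Set.Icc (0 : ℝ) 1 | √b ≤ m} = ∅ := by
      ext b
      simp only [Set.mem_ofPred_eq, Set.mem_empty_iff_false, iff_false, not_and, not_le]
      exact fun _ => h.trans_le (Real.sqrt_nonneg b)
    rw [this, max_eq_left h.le]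
    simp
  · have : {b ∈ Set.Icc (0 : ℝ) 1 | √b ≤ m} = Set.Icc 0 (m ^ 2) := by
      ext b
      simp only [Set.mem_ofPred_eq, Set.mem_Icc, Real.sqrt_le_left h]
      constructor
      · rintro ⟨⟨h1, -⟩, h2⟩; exact ⟨h1, h2⟩
      · rintro ⟨h1, h2⟩; exact ⟨⟨h1, by nlinarith⟩, h2⟩
    rw [this, max_eq_right h, Real.volume_Icc, sub_zero]

lemma volume_sqrt_one_sub_le {m : ℝ} (hm : m ≤ 1) :
    volume {b ∈ Set.Icc (0 : ℝ) 1 | √(1 - b) ≤ m} = ENNReal.ofReal (max 0 m ^ 2) := by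
  have hms : MeasurableSet {b ∈ Set.Icc (0 : ℝ) 1 | √b ≤ m} :=
    measurableSet_Icc.inter (measurableSet_le Real.continuous_sqrt.measurable measurable_const)
  have hmp := Measure.measurePreserving_sub_left (volume : Measure ℝ) 1
  rw [← volume_sqrt_le hm, ← hmp.measure_preimage hms.nullMeasurableSet]
  congr 1
  ext b
  simp only [Set.mem_ofPred_eq, Set.mem_Icc, Set.mem_preimage]
  constructor <;> rintro ⟨⟨h1, h2⟩, h3⟩ <;> exact ⟨⟨by linarith, by linarith⟩, h3⟩

/-- For unit vectors `(p, q)`, `(x, y)`, `(c, s)` of the first quadrant, at angles `α`, `β`, `θ`: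
if `cos β ≤ cos (α + θ)`, then `sin θ ≤ sin (β - α)`. -/
lemma le_mul_sub_mul_of_le {p q x y c s : ℝ} (hp : 0 ≤ p) (hq : 0 ≤ q) (hx : 0 ≤ x) (hy : 0 ≤ y)
    (hc : 0 ≤ c) (hs : 0 ≤ s) (hpq : p ^ 2 + q ^ 2 = 1) (hxy : x ^ 2 + y ^ 2 = 1)
    (hcs : c ^ 2 + s ^ 2 = 1) (h : x ≤ p * c - q * s) : s ≤ p * y - q * x := by
  have hsum : (p * s + q * c) ^ 2 + (p * c - q * s) ^ 2 = 1 := by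
    linear_combination (c ^ 2 + s ^ 2) * hpq + hcs
  have hxle : x ^ 2 ≤ (p * c - q * s) ^ 2 := pow_le_pow_left₀ hx h 2
  have hyle : p * s + q * c ≤ y :=
    (pow_le_pow_iff_left₀ (by positivity) hy two_ne_zero).1 (by linarith)
  have hs' : s = p * (p * s + q * c) - q * (p * c - q * s) := by linear_combination -s * hpq
  have h1 := mul_le_mul_of_nonneg_left hyle hp
  have h2 := mul_le_mul_of_nonneg_left h hq
  linarith

/-- For unit vectors `(p, q)`, `(x, y)`, `(c, s)` of the first quadrant, at angles `α`, `β`, `θ`: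
`cos (α - β) ≤ cos θ` means that `β ≥ α + θ` or `β ≤ α - θ`. -/
lemma mul_add_mul_le_iff {p q x y c s : ℝ} (hp : 0 ≤ p) (hq : 0 ≤ q) (hx : 0 ≤ x) (hy : 0 ≤ y)
    (hc : 0 ≤ c) (hs : 0 ≤ s) (hpq : p ^ 2 + q ^ 2 = 1) (hxy : x ^ 2 + y ^ 2 = 1)
    (hcs : c ^ 2 + s ^ 2 = 1) :
    p * x + q * y ≤ c ↔ x ≤ p * c - q * s ∨ y ≤ q * c - p * s := by
  have hrot : (p * x + q * y) ^ 2 + (q * x - p * y) ^ 2 = 1 := by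
    linear_combination (x ^ 2 + y ^ 2) * hpq + hxy
  have hnn : 0 ≤ p * x + q * y := by positivity
  constructor
  · intro h
    have h2 : s ^ 2 ≤ (q * x - p * y) ^ 2 := by
      have := pow_le_pow_left₀ hnn h 2
      linarith
    have h3 := sq_le_sq.1 h2
    rw [abs_of_nonneg hs] at h3
    have hpc := mul_le_mul_of_nonneg_left h hp
    have hqc := mul_le_mul_of_nonneg_left h hq
    rcases le_abs'.1 h3 with h3 | h3
    · left
      have hx' : x = p * (p * x + q * y) + q * (q * x - p * y) := by linear_combination -x * hpq
      have := mul_le_mul_of_nonneg_left h3 hq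
      linarith
    · right
      have hy' : y = q * (p * x + q * y) - p * (q * x - p * y) := by linear_combination -y * hpq
      have := mul_le_mul_of_nonneg_left h3 hp
      linarith
  · intro h
    have h2 : s ^ 2 ≤ (q * x - p * y) ^ 2 := by
      rcases h with h | h
      · have := pow_le_pow_left₀ hs (le_mul_sub_mul_of_le hp hq hx hy hc hs hpq hxy hcs h) 2
        linarith
      · exact pow_le_pow_left₀ hs (le_mul_sub_mul_of_le hq hp hy hx hc hs (by linarith)
          (by linarith) hcs h) 2
    exact (pow_le_pow_iff_left₀ hnn hc two_ne_zero).1 (by linarith)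

/-- The law of the compensated gain for one fixed singular vector, with `|v₁|² = a`, and a uniform
squared modulus `b` of the other one. -/
lemma volume_slice {a z : ℝ} (ha : a ∈ Set.Icc (0 : ℝ) 1) (hz : z ∈ Set.Ioo (0 : ℝ) 1) :
    volume {b ∈ Set.Icc (0 : ℝ) 1 | (√a * √b + √(1 - a) * √(1 - b)) ^ 2 ≤ z}
      = ENNReal.ofReal (max 0 (√a * √z - √(1 - a) * √(1 - z)) ^ 2
        + max 0 (√(1 - a) * √z - √a * √(1 - z)) ^ 2) := by
  have hpq : √a ^ 2 + √(1 - a) ^ 2 = 1 := by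
    rw [Real.sq_sqrt ha.1, Real.sq_sqrt (by linarith [ha.2])]; ring
  have hcs : √z ^ 2 + √(1 - z) ^ 2 = 1 := by
    rw [Real.sq_sqrt hz.1.le, Real.sq_sqrt (by linarith [hz.2])]; ring
  have hs : 0 < √(1 - z) := Real.sqrt_pos.2 (by linarith [hz.2])
  have hset : {b ∈ Set.Icc (0 : ℝ) 1 | (√a * √b + √(1 - a) * √(1 - b)) ^ 2 ≤ z}
      = {b ∈ Set.Icc (0 : ℝ) 1 | √b ≤ √a * √z - √(1 - a) * √(1 - z)}
        ∪ {b ∈ Set.Icc (0 : ℝ) 1 | √(1 - b) ≤ √(1 - a) * √z - √a * √(1 - z)} := by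
    ext b
    simp only [Set.mem_union, Set.mem_ofPred_eq]
    rw [← and_or_left]
    refine and_congr_right fun hb => ?_
    have hxy : √b ^ 2 + √(1 - b) ^ 2 = 1 := by
      rw [Real.sq_sqrt hb.1, Real.sq_sqrt (by linarith [hb.2])]; ring
    rw [← Real.le_sqrt (by positivity) hz.1.le]
    exact mul_add_mul_le_iff (by positivity) (by positivity) (by positivity) (by positivity)
      (by positivity) (by positivity) hpq hxy hcs
  have hdisj : Disjoint {b ∈ Set.Icc (0 : ℝ) 1 | √b ≤ √a * √z - √(1 - a) * √(1 - z)}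
      {b ∈ Set.Icc (0 : ℝ) 1 | √(1 - b) ≤ √(1 - a) * √z - √a * √(1 - z)} := by
    rw [Set.disjoint_left]
    rintro b ⟨hb, h1⟩ ⟨-, h2⟩
    have hxy : √b ^ 2 + √(1 - b) ^ 2 = 1 := by
      rw [Real.sq_sqrt hb.1, Real.sq_sqrt (by linarith [hb.2])]; ring
    have h3 := le_mul_sub_mul_of_le (Real.sqrt_nonneg _) (Real.sqrt_nonneg _) (Real.sqrt_nonneg _)
      (Real.sqrt_nonneg _) (Real.sqrt_nonneg _) hs.le hpq hxy hcs h1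
    have h4 := le_mul_sub_mul_of_le (Real.sqrt_nonneg _) (Real.sqrt_nonneg _) (Real.sqrt_nonneg _)
      (Real.sqrt_nonneg _) (Real.sqrt_nonneg _) hs.le ((add_comm _ _).trans hpq)
      ((add_comm _ _).trans hxy) hcs h2
    linarith
  have hle : ∀ p q : ℝ, 0 ≤ q → p ≤ 1 → p * √z - q * √(1 - z) ≤ 1 := by
    intro p q hq hp
    have h1 : √z ≤ 1 := Real.sqrt_le_one.2 hz.2.le
    have := Real.sqrt_nonneg z
    nlinarith
  have hm : MeasurableSet {b ∈ Set.Icc (0 : ℝ) 1 | √(1 - b) ≤ √(1 - a) * √z - √a * √(1 - z)} :=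
    measurableSet_Icc.inter (measurableSet_le (f := fun b : ℝ => √(1 - b)) (by fun_prop)
      measurable_const)
  rw [hset, measure_union hdisj hm,
    volume_sqrt_le (hle _ _ (Real.sqrt_nonneg _) (Real.sqrt_le_one.2 ha.2)),
    volume_sqrt_one_sub_le (hle _ _ (Real.sqrt_nonneg _) (Real.sqrt_le_one.2 (by linarith [ha.1]))),
    ENNReal.ofReal_add (by positivity) (by positivity)]

lemma integral_max_sq {z : ℝ} (hz : z ∈ Set.Ioo (0 : ℝ) 1) :
    ∫ a in (0 : ℝ)..1, max 0 (√(1 - a) * √z - √a * √(1 - z)) ^ 2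
      = (z - √(z * (1 - z)) * Real.arcsin √z) / 2 := by
  have hz0 := hz.1
  have hz1 : 0 < 1 - z := sub_pos.2 hz.2
  have hcont : Continuous (fun a : ℝ => max 0 (√(1 - a) * √z - √a * √(1 - z)) ^ 2) := by fun_prop
  rw [← intervalIntegral.integral_add_adjacent_intervals (hcont.intervalIntegrable 0 z)
    (hcont.intervalIntegrable z 1)]
  have hright : ∫ a in z..1, max 0 (√(1 - a) * √z - √a * √(1 - z)) ^ 2 = 0 := by
    rw [intervalIntegral.integral_congr (g := fun _ => 0)]
    · simp
    · intro a ha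
      rw [Set.uIcc_of_le hz.2.le] at ha
      have h1 : √(1 - a) ≤ √(1 - z) := Real.sqrt_le_sqrt (by linarith [ha.1])
      have h2 : √z ≤ √a := Real.sqrt_le_sqrt ha.1
      have h3 : √(1 - a) * √z - √a * √(1 - z) ≤ 0 := by
        have := mul_le_mul h1 h2 (Real.sqrt_nonneg _) (Real.sqrt_nonneg _)
        linarith
      simp [max_eq_left h3]
  have hleft : ∫ a in (0 : ℝ)..z, max 0 (√(1 - a) * √z - √a * √(1 - z)) ^ 2
      = ∫ a in (0 : ℝ)..z, (z + (1 - 2 * z) * a - 2 * √(z * (1 - z)) * √(a * (1 - a))) := by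
    refine intervalIntegral.integral_congr fun a ha => ?_
    rw [Set.uIcc_of_le hz0.le] at ha
    have h0 : 0 ≤ 1 - a := by linarith [ha.2]
    have h1 : √(1 - z) ≤ √(1 - a) := Real.sqrt_le_sqrt (by linarith [ha.2])
    have h2 : √a ≤ √z := Real.sqrt_le_sqrt ha.2
    have h3 : 0 ≤ √(1 - a) * √z - √a * √(1 - z) := by
      have := mul_le_mul h1 h2 (Real.sqrt_nonneg _) (Real.sqrt_nonneg _)
      linarith
    rw [max_eq_right h3, Real.sqrt_mul hz0.le, Real.sqrt_mul ha.1]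
    linear_combination √z ^ 2 * Real.sq_sqrt h0 + (1 - a) * Real.sq_sqrt hz0.le
      + √a ^ 2 * Real.sq_sqrt hz1.le + (1 - z) * Real.sq_sqrt ha.1
  have hftc : ∫ a in (0 : ℝ)..z, (z + (1 - 2 * z) * a - 2 * √(z * (1 - z)) * √(a * (1 - a)))
      = (fun a => z * a + (1 - 2 * z) * a ^ 2 / 2 - 2 * √(z * (1 - z)) *
          ((Real.arcsin √a - (1 - 2 * a) * √(a * (1 - a))) / 4)) z
        - (fun a => z * a + (1 - 2 * z) * a ^ 2 / 2 - 2 * √(z * (1 - z)) *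
          ((Real.arcsin √a - (1 - 2 * a) * √(a * (1 - a))) / 4)) 0 := by
    refine intervalIntegral.integral_eq_sub_of_hasDerivAt_of_le
      (f := fun a => z * a + (1 - 2 * z) * a ^ 2 / 2 - 2 * √(z * (1 - z)) *
          ((Real.arcsin √a - (1 - 2 * a) * √(a * (1 - a))) / 4)) hz0.le
      (Continuous.continuousOn ?_) (fun a ha => ?_) (Continuous.intervalIntegrable ?_ _ _)
    · have := Real.continuous_arcsin
      fun_prop
    · have h := hasDerivAt_arcsin_sqrt_sub ha.1 (ha.2.trans hz.2)
      have hsq : HasDerivAt (fun a : ℝ => (1 - 2 * z) * a ^ 2 / 2) ((1 - 2 * z) * a) a := by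
        refine (((hasDerivAt_pow 2 a).const_mul (1 - 2 * z)).div_const 2).congr_deriv ?_
        simp
        ring
      refine ((((hasDerivAt_id a).const_mul z).add hsq).sub
        (h.const_mul (2 * √(z * (1 - z))))).congr_deriv ?_
      ring
    · fun_prop
  rw [hright, hleft, hftc]
  simp only [Real.sqrt_zero, Real.arcsin_zero, zero_mul, mul_zero, sub_zero]
  have hsq : √(z * (1 - z)) ^ 2 = z * (1 - z) := Real.sq_sqrt (by positivity)
  linear_combination ((1 - 2 * z) / 2) * hsq

/-- The distribution function of the compensated gain, for independent uniform squared moduli of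
the first coordinates of the two singular vectors. -/
lemma uniform_prod_compensated_le {z : ℝ} (hz : z ∈ Set.Ioo (0 : ℝ) 1) :
    ((volume.restrict (Set.Icc (0 : ℝ) 1)).prod (volume.restrict (Set.Icc (0 : ℝ) 1)))
      {p | (√p.1 * √p.2 + √(1 - p.1) * √(1 - p.2)) ^ 2 ≤ z}
      = ENNReal.ofReal (z - √(z * (1 - z)) * Real.arcsin √z) := by
  have hm : MeasurableSet {p : ℝ × ℝ | (√p.1 * √p.2 + √(1 - p.1) * √(1 - p.2)) ^ 2 ≤ z} :=
    measurableSet_le (by fun_prop) (by fun_prop)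
  have hcont : Continuous (fun a : ℝ => max 0 (√(1 - a) * √z - √a * √(1 - z)) ^ 2) := by fun_prop
  have hcont' : Continuous (fun a : ℝ => max 0 (√a * √z - √(1 - a) * √(1 - z)) ^ 2) := by fun_prop
  rw [Measure.prod_apply hm]
  have hslice : ∀ a ∈ Set.Icc (0 : ℝ) 1, (volume.restrict (Set.Icc (0 : ℝ) 1)) (Prod.mk a ⁻¹'
      {p : ℝ × ℝ | (√p.1 * √p.2 + √(1 - p.1) * √(1 - p.2)) ^ 2 ≤ z})
      = ENNReal.ofReal (max 0 (√a * √z - √(1 - a) * √(1 - z)) ^ 2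
        + max 0 (√(1 - a) * √z - √a * √(1 - z)) ^ 2) := by
    intro a ha
    rw [Measure.restrict_apply (measurable_prodMk_left hm), ← volume_slice ha hz]
    congr 1
    ext b
    simp [and_comm]
  have hint : IntegrableOn (fun a : ℝ => max 0 (√a * √z - √(1 - a) * √(1 - z)) ^ 2
      + max 0 (√(1 - a) * √z - √a * √(1 - z)) ^ 2) (Set.Icc 0 1) :=
    (hcont'.add hcont).continuousOn.integrableOn_compact isCompact_Icc
  rw [setLIntegral_congr_fun measurableSet_Icc hslice, ← ofReal_integral_eq_lintegral_ofReal hint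
    (Filter.Eventually.of_forall fun a => by positivity), integral_Icc_eq_integral_Ioc,
    ← intervalIntegral.integral_of_le zero_le_one,
    intervalIntegral.integral_add (hcont'.intervalIntegrable 0 1) (hcont.intervalIntegrable 0 1)]
  -- The two parts of the slice are exchanged by `a ↦ 1 - a`.
  have hswap := intervalIntegral.integral_comp_sub_left (a := 0) (b := 1)
    (fun a : ℝ => max 0 (√a * √z - √(1 - a) * √(1 - z)) ^ 2) 1
  simp only [sub_sub_cancel, sub_zero, sub_self] at hswap
  rw [← hswap, integral_max_sq hz]
  congr 1
  ring

/-! ### Laws of the two gains -/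

lemma phaseMatrix_mem_unitaryGroup (φ : Fin 2 → ℝ) :
    phaseMatrix φ ∈ Matrix.unitaryGroup (Fin 2) ℂ := by
  rw [Matrix.mem_unitaryGroup_iff', Matrix.star_eq_conjTranspose, phaseMatrix,
    Matrix.diagonal_conjTranspose, Matrix.diagonal_mul_diagonal, ← Matrix.diagonal_one]
  congr 1
  ext k
  rw [Pi.star_apply, RCLike.star_def, Complex.conj_mul', mul_comm, Complex.norm_exp_ofReal_mul_I]
  simp

/-- The value of `spectralGain s M` at `T w`, for a unit vector `w` and a unitary matrix `T`, in
terms of `M` and of a second matrix `N` that has `w` as its right singular vector with sign `s'`.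
Unlike `w` itself, it is a function of `M` and `N`. -/
noncomputable def pairGain (s s' : ℝ) (T M N : Matrix (Fin 2) (Fin 2) ℂ) : ℝ :=
  (1 + s * (2 * (spectralGain s' N (star ((M * T).row 0))
      + spectralGain s' N (star ((M * T).row 1))) - frobSq M)
    / √(frobSq M ^ 2 - 4 * ‖M.det‖ ^ 2)) / 2

lemma measurable_pairGain (s s' : ℝ) (T : Matrix (Fin 2) (Fin 2) ℂ) :
    Measurable (fun p : (Fin 2 × Fin 2 → ℂ) × (Fin 2 × Fin 2 → ℂ) =>
      pairGain s s' T (matrixOfEntries p.1) (matrixOfEntries p.2)) := by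
  have h : ∀ k : Fin 2, Measurable (fun p : (Fin 2 × Fin 2 → ℂ) × (Fin 2 × Fin 2 → ℂ) =>
      spectralGain s' (matrixOfEntries p.2) (star ((matrixOfEntries p.1 * T).row k))) := by
    intro k
    have hg : Measurable (fun p : (Fin 2 × Fin 2 → ℂ) × (Fin 2 × Fin 2 → ℂ) =>
        (p.2, star ((matrixOfEntries p.1 * T).row k))) := by
      refine measurable_snd.prodMk (measurable_pi_lambda _ fun l => ?_)
      simp only [Pi.star_apply, Matrix.row_apply, Matrix.mul_apply, matrixOfEntries,
        Matrix.of_apply, Fin.sum_univ_two, RCLike.star_def]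
      fun_prop
    simpa only [Function.comp_def] using (measurable_spectralGain s').comp hg
  have h0 := h 0
  have h1 := h 1
  have hf : Measurable (fun p : (Fin 2 × Fin 2 → ℂ) × (Fin 2 × Fin 2 → ℂ) =>
      frobSq (matrixOfEntries p.1)) := by
    simp only [frobSq, matrixOfEntries, Matrix.of_apply]
    fun_prop
  have hd : Measurable (fun p : (Fin 2 × Fin 2 → ℂ) × (Fin 2 × Fin 2 → ℂ) =>
      (matrixOfEntries p.1).det) := by
    simp only [Matrix.det_fin_two, matrixOfEntries, Matrix.of_apply]
    fun_prop
  unfold pairGain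
  fun_prop

lemma pairGain_eq {T : Matrix (Fin 2) (Fin 2) ℂ} (hT : T ∈ Matrix.unitaryGroup (Fin 2) ℂ)
    (s s' : ℝ) (M N : Matrix (Fin 2) (Fin 2) ℂ) {w : Fin 2 → ℂ} (hw : sqNorm w = 1)
    (hN : ∀ u, spectralGain s' N u = ‖star w ⬝ᵥ u‖ ^ 2) :
    pairGain s s' T M N = spectralGain s M (T *ᵥ w) := by
  have hk : ∀ k, ‖star w ⬝ᵥ star ((M * T).row k)‖ ^ 2 = ‖(M *ᵥ (T *ᵥ w)) k‖ ^ 2 := by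
    intro k
    rw [Matrix.star_dotProduct_star, norm_star, Matrix.mulVec_mulVec]
    rfl
  rw [pairGain, hN, hN, hk, hk, spectralGain, sqNorm_mulVec_of_mem_unitaryGroup hT, hw, mul_one]
  rfl

section

variable {Ω : Type*} [MeasurableSpace Ω] {μ : Measure Ω} [IsProbabilityMeasure μ]
  {G H U V W Q : Ω → Matrix (Fin 2) (Fin 2) ℂ} {lam om : Ω → Fin 2 → ℝ}

lemma hasLaw_entries_prod (hG : HasLaw (fun x => entriesOfMatrix (G x)) gaussianEntries μ)
    (hH : HasLaw (fun x => entriesOfMatrix (H x)) gaussianEntries μ)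
    (hGH : IndepFun (fun x => entriesOfMatrix (G x)) (fun x => entriesOfMatrix (H x)) μ) :
    HasLaw (fun x => (entriesOfMatrix (G x), entriesOfMatrix (H x)ᴴ))
      (gaussianEntries.prod gaussianEntries) μ where
  aemeasurable := hG.aemeasurable.prodMk (hasLaw_conjTranspose_entries hH).aemeasurable
  map_eq := by
    have h := hGH.comp measurable_id measurePreserving_conjTranspose.measurable
    have hH' := hasLaw_conjTranspose_entries hH
    have h2 := (indepFun_iff_map_prod_eq_prod_map_map hG.aemeasurable hH'.aemeasurable).1 h
    rwa [hG.map_eq, hH'.map_eq] at h2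

/-- The uncompensated gain is uniform: for a fixed right factor it is the squared projection of a
singular vector of `G` onto a fixed unit vector. -/
lemma hasLaw_uncompensatedGain
    (hG : HasLaw (fun x => entriesOfMatrix (G x)) gaussianEntries μ)
    (hH : HasLaw (fun x => entriesOfMatrix (H x)) gaussianEntries μ)
    (hGH : IndepFun (fun x => entriesOfMatrix (G x)) (fun x => entriesOfMatrix (H x)) μ)
    (hGsvd : ∀ᵐ x ∂μ, IsOrderedSVD (G x) (U x) (lam x) (V x))
    (hHsvd : ∀ᵐ x ∂μ, IsOrderedSVD (H x) (W x) (om x) (Q x))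
    (φ : Fin 2 → ℝ) (i j : Fin 2) :
    HasLaw (fun x => uncompensatedGain φ ((V x).col j) ((W x).col i))
      (volume.restrict (Set.Icc (0 : ℝ) 1)) μ := by
  have hΦ := phaseMatrix_mem_unitaryGroup φ
  have hjoint := hasLaw_entries_prod hG hH hGH
  have hH' := hasLaw_conjTranspose_entries hH
  have hHsvd' : ∀ᵐ x ∂μ, IsOrderedSVD (H x)ᴴ (Q x) (om x) (W x) := by
    filter_upwards [hHsvd] with x hx using hx.conjTranspose
  set K := fun p : (Fin 2 × Fin 2 → ℂ) × (Fin 2 × Fin 2 → ℂ) =>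
    pairGain (singularSign j) (singularSign i) (phaseMatrix φ) (matrixOfEntries p.1)
      (matrixOfEntries p.2) with hK
  have hKm : Measurable K := measurable_pairGain _ _ _
  have hKeq : ∀ᵐ x ∂μ, ∀ z, K (z, entriesOfMatrix (H x)ᴴ)
      = spectralGain (singularSign j) (matrixOfEntries z) (phaseMatrix φ *ᵥ (W x).col i) := by
    filter_upwards [hHsvd', ae_spectralGain_eq hH' hHsvd'] with x hx hg z
    exact pairGain_eq hΦ _ _ _ _ (hx.sqNorm_col i) (hg i)
  have hae : (fun x => uncompensatedGain φ ((V x).col j) ((W x).col i))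
      =ᵐ[μ] fun x => K (entriesOfMatrix (G x), entriesOfMatrix (H x)ᴴ) := by
    filter_upwards [hKeq, ae_spectralGain_eq hG hGsvd] with x hx hg
    rw [hx, matrixOfEntries_entriesOfMatrix, hg]
    rfl
  have hcomp : AEMeasurable (fun x => K (entriesOfMatrix (G x), entriesOfMatrix (H x)ᴴ)) μ :=
    hKm.comp_aemeasurable hjoint.aemeasurable
  refine ⟨hcomp.congr hae.symm, ?_⟩
  rw [Measure.map_congr hae]
  ext B hB
  have hS := hKm hB
  have h1 : μ.map (fun x => K (entriesOfMatrix (G x), entriesOfMatrix (H x)ᴴ))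
      = (gaussianEntries.prod gaussianEntries).map K := by
    rw [← hjoint.map_eq, AEMeasurable.map_map_of_aemeasurable hKm.aemeasurable hjoint.aemeasurable]
    rfl
  rw [h1, Measure.map_apply hKm hB, Measure.prod_apply_symm hS]
  have h2 : ∫⁻ y, gaussianEntries ((fun z => (z, y)) ⁻¹' (K ⁻¹' B)) ∂gaussianEntries
      = ∫⁻ x, gaussianEntries ((fun z => (z, entriesOfMatrix (H x)ᴴ)) ⁻¹' (K ⁻¹' B)) ∂μ := by
    conv_lhs => rw [← hH'.map_eq]
    rw [lintegral_map' _ hH'.aemeasurable]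
    · rw [hH'.map_eq]
    · rw [hH'.map_eq]
      exact (measurable_measure_prodMk_right hS).aemeasurable
  rw [h2]
  have h3 : ∀ᵐ x ∂μ, gaussianEntries ((fun z => (z, entriesOfMatrix (H x)ᴴ)) ⁻¹' (K ⁻¹' B))
      = volume.restrict (Set.Icc (0 : ℝ) 1) B := by
    filter_upwards [hHsvd', hKeq] with x hx hk
    have hu : sqNorm (phaseMatrix φ *ᵥ (W x).col i) = 1 := by
      rw [sqNorm_mulVec_of_mem_unitaryGroup hΦ, hx.sqNorm_col]
    rw [← map_spectralGain hG hGsvd j hu, Measure.map_apply (measurable_spectralGain_left _ _) hB]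
    congr 1
    ext z
    simp only [Set.mem_preimage, hk]
  rw [lintegral_congr_ae h3]
  simp

/-- The compensated gain depends only on the squared moduli of the first coordinates of the two
singular vectors, which are independent and uniform. -/
lemma exists_hasLaw_compensatedGain_eq
    (hG : HasLaw (fun x => entriesOfMatrix (G x)) gaussianEntries μ)
    (hH : HasLaw (fun x => entriesOfMatrix (H x)) gaussianEntries μ)
    (hGH : IndepFun (fun x => entriesOfMatrix (G x)) (fun x => entriesOfMatrix (H x)) μ)
    (hGsvd : ∀ᵐ x ∂μ, IsOrderedSVD (G x) (U x) (lam x) (V x))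
    (hHsvd : ∀ᵐ x ∂μ, IsOrderedSVD (H x) (W x) (om x) (Q x)) (i j : Fin 2) :
    ∃ P : Ω → ℝ × ℝ,
      HasLaw P ((volume.restrict (Set.Icc (0 : ℝ) 1)).prod
        (volume.restrict (Set.Icc (0 : ℝ) 1))) μ ∧
      (fun x => compensatedGain ((V x).col j) ((W x).col i)) =ᵐ[μ]
        fun x => (√(P x).1 * √(P x).2 + √(1 - (P x).1) * √(1 - (P x).2)) ^ 2 := by
  have hjoint := hasLaw_entries_prod hG hH hGH
  have hH' := hasLaw_conjTranspose_entries hH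
  have hHsvd' : ∀ᵐ x ∂μ, IsOrderedSVD (H x)ᴴ (Q x) (om x) (W x) := by
    filter_upwards [hHsvd] with x hx using hx.conjTranspose
  set e : Fin 2 → ℂ := Pi.single 0 1 with he_def
  have he : sqNorm e = 1 := by simp [sqNorm, he_def]
  let f : Fin 2 → (Fin 2 × Fin 2 → ℂ) → ℝ := fun k z =>
    spectralGain (singularSign k) (matrixOfEntries z) e
  have hm : ∀ k, Measurable (f k) := fun k => measurable_spectralGain_left _ e
  have hF : Measurable (Prod.map (f j) (f i)) := (hm j).prodMap (hm i)
  have hj : gaussianEntries.map (f j) = volume.restrict (Set.Icc (0 : ℝ) 1) :=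
    map_spectralGain hG hGsvd j he
  have hi : gaussianEntries.map (f i) = volume.restrict (Set.Icc (0 : ℝ) 1) :=
    map_spectralGain hH' hHsvd' i he
  refine ⟨Prod.map (f j) (f i) ∘ fun x => (entriesOfMatrix (G x), entriesOfMatrix (H x)ᴴ),
    ⟨hF.comp_aemeasurable hjoint.aemeasurable, ?_⟩, ?_⟩
  · rw [← AEMeasurable.map_map_of_aemeasurable hF.aemeasurable hjoint.aemeasurable, hjoint.map_eq,
      ← Measure.map_prod_map _ _ (hm j) (hm i), hj, hi]
  · filter_upwards [hGsvd, hHsvd', ae_spectralGain_eq hG hGsvd, ae_spectralGain_eq hH' hHsvd']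
      with x hx hy hgx hgy
    have h1 := hx.sqNorm_col j
    have h2 := hy.sqNorm_col i
    unfold sqNorm at h1 h2
    simp only [Function.comp_apply, Prod.map, f, matrixOfEntries_entriesOfMatrix, hgx, hgy, he_def,
      dotProduct_single_one, Pi.star_apply, norm_star, compensatedGain]
    rw [← eq_sub_iff_add_eq'.2 h1, ← eq_sub_iff_add_eq'.2 h2]
    simp only [Real.sqrt_sq (norm_nonneg _)]

end

theorem theorem2 {Ω : Type*} [MeasurableSpace Ω] (μ : Measure Ω) [IsProbabilityMeasure μ]
    (G H U V W Q : Ω → Matrix (Fin 2) (Fin 2) ℂ) (lam om : Ω → Fin 2 → ℝ)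
    (hG : IsIIDGaussianMatrix μ G) (hH : IsIIDGaussianMatrix μ H)
    (hGH : IndepFun (fun x (p : Fin 2 × Fin 2) => G x p.1 p.2)
      (fun x (p : Fin 2 × Fin 2) => H x p.1 p.2) μ)
    (hGsvd : ∀ᵐ x ∂μ, IsOrderedSVD (G x) (U x) (lam x) (V x))
    (hHsvd : ∀ᵐ x ∂μ, IsOrderedSVD (H x) (W x) (om x) (Q x))
    (φ : Fin 2 → ℝ) (i j : Fin 2) :
    (AEMeasurable (fun x => compensatedGain ((V x).col j) ((W x).col i)) μ ∧
      ∀ z ∈ Set.Ioo (0 : ℝ) 1,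
        cdf (μ.map (fun x => compensatedGain ((V x).col j) ((W x).col i))) z
          = z - Real.sqrt (z * (1 - z)) * Real.arcsin (Real.sqrt z)) ∧
    (AEMeasurable (fun x => uncompensatedGain φ ((V x).col j) ((W x).col i)) μ ∧
      (∀ z ∈ Set.Ioo (0 : ℝ) 1,
        cdf (μ.map (fun x => uncompensatedGain φ ((V x).col j) ((W x).col i))) z = z) ∧
      μ.map (fun x => uncompensatedGain φ ((V x).col j) ((W x).col i))
        = volume.restrict (Set.Icc (0 : ℝ) 1)) := by
  have hG' := hG.hasLaw_entries
  have hH' := hH.hasLaw_entries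
  have hunc := hasLaw_uncompensatedGain hG' hH' hGH hGsvd hHsvd φ i j
  obtain ⟨P, hP, hPeq⟩ := exists_hasLaw_compensatedGain_eq hG' hH' hGH hGsvd hHsvd i j
  have hf : Measurable (fun p : ℝ × ℝ => (√p.1 * √p.2 + √(1 - p.1) * √(1 - p.2)) ^ 2) := by
    fun_prop
  have hcm : AEMeasurable (fun x => compensatedGain ((V x).col j) ((W x).col i)) μ :=
    (hf.comp_aemeasurable hP.aemeasurable).congr hPeq.symm
  refine ⟨⟨hcm, fun z hz => ?_⟩, hunc.aemeasurable, fun z hz => ?_, hunc.map_eq⟩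
  · have := Measure.isProbabilityMeasure_map hcm
    have hmap : μ.map (fun x => compensatedGain ((V x).col j) ((W x).col i))
        = ((volume.restrict (Set.Icc (0 : ℝ) 1)).prod (volume.restrict (Set.Icc (0 : ℝ) 1))).map
          (fun p => (√p.1 * √p.2 + √(1 - p.1) * √(1 - p.2)) ^ 2) := by
      rw [Measure.map_congr hPeq, ← hP.map_eq,
        AEMeasurable.map_map_of_aemeasurable hf.aemeasurable hP.aemeasurable]
      rfl
    rw [cdf_eq_real, measureReal_def, hmap, Measure.map_apply hf measurableSet_Iic]
    have hset := uniform_prod_compensated_le hz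
    have hnn : 0 ≤ z - √(z * (1 - z)) * Real.arcsin √z := by
      -- Half of this number is the integral of a square.
      have h := integral_max_sq hz
      have h0 : 0 ≤ ∫ a in (0 : ℝ)..1, max 0 (√(1 - a) * √z - √a * √(1 - z)) ^ 2 :=
        intervalIntegral.integral_nonneg zero_le_one fun a _ => by positivity
      linarith
    change (((volume.restrict (Set.Icc (0 : ℝ) 1)).prod (volume.restrict (Set.Icc (0 : ℝ) 1)))
      {p | (√p.1 * √p.2 + √(1 - p.1) * √(1 - p.2)) ^ 2 ≤ z}).toReal = _
    rw [hset, ENNReal.toReal_ofReal hnn]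
  · have := Measure.isProbabilityMeasure_map hunc.aemeasurable
    have hset : Set.Iic z ∩ Set.Icc (0 : ℝ) 1 = Set.Icc 0 z := by
      ext t
      simp only [Set.mem_inter_iff, Set.mem_Iic, Set.mem_Icc]
      exact ⟨fun h => ⟨h.2.1, h.1⟩, fun h => ⟨h.2, h.1, h.2.trans hz.2.le⟩⟩
    rw [cdf_eq_real, measureReal_def, hunc.map_eq, Measure.restrict_apply measurableSet_Iic, hset]
    simp [hz.1.le]
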